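/- Let $a_1<a_2<a_3<a_4$ be real numbers, $P(x)=\prod_{i=1}^4(x-a_i)$, $\sigma=\frac14\sum_{i=1}^4 a_i$, and $$L\psi=(P\psi')'+2(x-\sigma)^2\psi .$$ For $j=2,3$ let $I_j=(a_j,a_{j+1})$ and let $D_{j,\max}$ be the set of $\psi:I_j\to\mathbb C$ such that $\psi$ and $P\psi'$ are absolutely continuous on every compact subinterval of $I_j$ and $\psi,L\psi\in L^2(I_j)$. Let $D_{\max}$ be the set of functions on $(a_2,a_3)\cup(a_3,a_4)$ whose restrictions to $I_2$ and $I_3$ lie in $D_{2,\max}$ and $D_{3,\max}$; functions are identified when they agree almost everywhere, so that $D_{\max}\subset L^2(a_2,a_4)$ (complex-valued functions). Put $[f,g]=f\,P\,\overline{g}'-\overline{g}\,P f'$, let $[f,g](a_i^{\pm})$ denote its one-sided limits at $a_i$, and set $$u(y)=1,\qquad v(y)=\sum_{i=1}^4\Big(\prod_{j\ne i}\frac1{a_i-a_j}\Big)\ln|y-a_i| .$$ Let $L_S$ be the operator $\psi\mapsto L\psi$ in $L^2(a_2,a_4)$ with domain $$D(L_S)=\{\psi\in D_{\max}:\ [\psi,u](a_2^+)=[\psi,u](a_4^-)=0,\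 [\psi,u](a_3^-)=[\psi,u](a_3^+),\ [\psi,v](a_3^-)=[\psi,v](a_3^+)\}.$$ **Proposition.** The spectrum of $L_S$ is simple, in the sense that every eigenvalue of $L_S$ has multiplicity one: if $\lambda\in\mathbb C$ and $L_S\psi=\lambda\psi$ for some nonzero $\psi\in D(L_S)$, then the eigenspace $\{\psi\in D(L_S): L_S\psi=\lambda\psi\}$ has complex dimension $1$. -/

import Mathlib

open MeasureTheory Set Filter Topology

noncomputable section

namespace SingularSL

/-! Throughout, `a : Fin 4 → ℝ` lists the four points `a₁ < a₂ < a₃ < a₄` as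
`a 0 < a 1 < a 2 < a 3`. Functions on `(a₂, a₃) ∪ (a₃, a₄)` are represented by functions
`ℝ → ℂ`, of which only the values on these two open intervals matter. -/

/-- `P(x) = ∏ᵢ (x - aᵢ)`. -/
def P (a : Fin 4 → ℝ) (x : ℝ) : ℝ := ∏ i, (x - a i)

/-- `σ = (a₁ + a₂ + a₃ + a₄) / 4`. -/
def sigma (a : Fin 4 → ℝ) : ℝ := (1 / 4) * ∑ i, a i

/-- The quasi-derivative `P ψ'`. -/
def quasiDeriv (a : Fin 4 → ℝ) (ψ : ℝ → ℂ) (x : ℝ) : ℂ := (P a x : ℂ) * deriv ψ x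

/-- The differential expression `L ψ = (P ψ')' + 2 (x - σ)² ψ`. -/
def L (a : Fin 4 → ℝ) (ψ : ℝ → ℂ) (x : ℝ) : ℂ :=
  deriv (quasiDeriv a ψ) x + ((2 * (x - sigma a) ^ 2 : ℝ) : ℂ) * ψ x

/-- `AC_loc(l, r)`: absolute continuity on all compact subintervals of `(l, r)`. -/
def ACLoc (f : ℝ → ℂ) (l r : ℝ) : Prop :=
  ∀ c ∈ Ioo l r, ∀ d ∈ Ioo l r, AbsolutelyContinuousOnInterval f c d

/-- Membership in the maximal domain of `L` on the interval `(l, r)`. The clause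
`differentiable` spells out that the derivative `ψ'`, whose product with `P` has to be locally
absolutely continuous, exists at every point of the open interval. -/
structure MemMaxOn (a : Fin 4 → ℝ) (l r : ℝ) (ψ : ℝ → ℂ) : Prop where
  ac : ACLoc ψ l r
  differentiable : DifferentiableOn ℝ ψ (Ioo l r)
  ac_quasiDeriv : ACLoc (quasiDeriv a ψ) l r
  memLp : MemLp ψ 2 (volume.restrict (Ioo l r))
  memLp_L : MemLp (L a ψ) 2 (volume.restrict (Ioo l r))

/-- The maximal domain on `(a₂, a₃) ∪ (a₃, a₄)`: the direct sum of the two maximal domains. -/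
def MemMax (a : Fin 4 → ℝ) (ψ : ℝ → ℂ) : Prop :=
  MemMaxOn a (a 1) (a 2) ψ ∧ MemMaxOn a (a 2) (a 3) ψ

/-- The Lagrange sesquilinear form `[f, g] = f P (conj g)' - (conj g) P f'`. -/
def lagrange (a : Fin 4 → ℝ) (f g : ℝ → ℂ) (x : ℝ) : ℂ :=
  f x * quasiDeriv a (fun y => star (g y)) x - star (g x) * quasiDeriv a f x

/-- The maximal domain function `u = 1`. -/
def u : ℝ → ℂ := fun _ => 1

/-- The maximal domain function `v(y) = ∑ᵢ (∏_{j ≠ i} 1 / (aᵢ - aⱼ)) ln |y - aᵢ|`. -/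
def v (a : Fin 4 → ℝ) (y : ℝ) : ℂ :=
  ((∑ i, (∏ j ∈ Finset.univ.erase i, 1 / (a i - a j)) * Real.log |y - a i| : ℝ) : ℂ)

/-- The functions in the domain of `L_S`: maximal domain functions with
`[ψ, u](a₂⁺) = [ψ, u](a₄⁻) = 0`, `[ψ, u](a₃⁻) = [ψ, u](a₃⁺)` and `[ψ, v](a₃⁻) = [ψ, v](a₃⁺)`,
the values at the singular points being one-sided limits. -/
structure MemDomain (a : Fin 4 → ℝ) (ψ : ℝ → ℂ) : Prop where
  mem_max : MemMax a ψ
  bc_left : Tendsto (lagrange a ψ u) (𝓝[>] (a 1)) (𝓝 0)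
  bc_right : Tendsto (lagrange a ψ u) (𝓝[<] (a 3)) (𝓝 0)
  trans_u : ∃ c : ℂ, Tendsto (lagrange a ψ u) (𝓝[<] (a 2)) (𝓝 c) ∧
    Tendsto (lagrange a ψ u) (𝓝[>] (a 2)) (𝓝 c)
  trans_v : ∃ c : ℂ, Tendsto (lagrange a ψ (v a)) (𝓝[<] (a 2)) (𝓝 c) ∧
    Tendsto (lagrange a ψ (v a)) (𝓝[>] (a 2)) (𝓝 c)

/-- The complex Hilbert space `L²(a₂, a₄)`. -/
abbrev H (a : Fin 4 → ℝ) : Type := Lp ℂ 2 (volume.restrict (Ioo (a 1) (a 3)))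

/-! ### Linearity of the differential expression -/

section linearity

variable {a : Fin 4 → ℝ} {l r : ℝ} {ψ φ : ℝ → ℂ}

lemma ACLoc.add {f g : ℝ → ℂ} (hf : ACLoc f l r) (hg : ACLoc g l r) :
    ACLoc (fun x => f x + g x) l r :=
  fun c hc d hd => (hf c hc d hd).fun_add (hg c hc d hd)

lemma ACLoc.smul {f : ℝ → ℂ} (k : ℂ) (hf : ACLoc f l r) :
    ACLoc (fun x => k * f x) l r :=
  fun c hc d hd => (hf c hc d hd).const_smul k

lemma ACLoc.congr {f g : ℝ → ℂ} (hf : ACLoc f l r) (h : EqOn f g (Ioo l r)) :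
    ACLoc g l r := by
  intro c hc d hd
  have hfi := hf c hc d hd
  have hsub : uIcc c d ⊆ Ioo l r := ordConnected_Ioo.uIcc_subset hc hd
  refine hfi.congr' ?_
  refine eventually_inf_principal.2 (Eventually.of_forall fun E hE => ?_)
  refine Finset.sum_congr rfl fun i hi => ?_
  rw [h (hsub (hE.1 i hi).1), h (hsub (hE.1 i hi).2)]

lemma ACLoc.ae_differentiableAt {f : ℝ → ℂ} (hf : ACLoc f l r) :
    ∀ᵐ x ∂(volume.restrict (Ioo l r)), DifferentiableAt ℝ f x := by
  have hlb : LocallyBoundedVariationOn f (Ioo l r) := by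
    intro c d hc hd
    refine ((hf c hc d hd).boundedVariationOn).mono ?_
    exact fun x hx => Icc_subset_uIcc hx.2
  filter_upwards [hlb.ae_differentiableWithinAt measurableSet_Ioo,
    ae_restrict_mem measurableSet_Ioo] with x hx hxm
  exact hx.differentiableAt (Ioo_mem_nhds hxm.1 hxm.2)

lemma MemMaxOn.differentiableAt (h : MemMaxOn a l r ψ) {x : ℝ} (hx : x ∈ Ioo l r) :
    DifferentiableAt ℝ ψ x :=
  (h.differentiable x hx).differentiableAt (Ioo_mem_nhds hx.1 hx.2)

lemma quasiDeriv_add (hψ : MemMaxOn a l r ψ) (hφ : MemMaxOn a l r φ) :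
    EqOn (fun x => quasiDeriv a ψ x + quasiDeriv a φ x)
      (quasiDeriv a (fun x => ψ x + φ x)) (Ioo l r) := by
  intro x hx
  simp only [quasiDeriv]
  rw [deriv_fun_add (hψ.differentiableAt hx) (hφ.differentiableAt hx)]
  ring

lemma quasiDeriv_smul (k : ℂ) (ψ : ℝ → ℂ) :
    quasiDeriv a (fun x => k * ψ x) = fun x => k * quasiDeriv a ψ x := by
  funext x
  simp only [quasiDeriv]
  rw [deriv_const_mul_field]
  ring

lemma L_add (hψ : MemMaxOn a l r ψ) (hφ : MemMaxOn a l r φ) :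
    (fun x => L a ψ x + L a φ x) =ᵐ[volume.restrict (Ioo l r)] L a (fun x => ψ x + φ x) := by
  filter_upwards [hψ.ac_quasiDeriv.ae_differentiableAt, hφ.ac_quasiDeriv.ae_differentiableAt,
    ae_restrict_mem measurableSet_Ioo] with x h1 h2 hx
  have he : quasiDeriv a (fun x => ψ x + φ x) =ᶠ[𝓝 x]
      fun x => quasiDeriv a ψ x + quasiDeriv a φ x :=
    ((quasiDeriv_add hψ hφ).eventuallyEq_of_mem (Ioo_mem_nhds hx.1 hx.2)).symm
  simp only [L]
  rw [he.deriv_eq, deriv_fun_add h1 h2]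
  ring

lemma L_smul (k : ℂ) (ψ : ℝ → ℂ) :
    L a (fun x => k * ψ x) = fun x => k * L a ψ x := by
  funext x
  simp only [L]
  rw [quasiDeriv_smul, deriv_const_mul_field]
  ring

lemma MemMaxOn.add (hψ : MemMaxOn a l r ψ) (hφ : MemMaxOn a l r φ) :
    MemMaxOn a l r (fun x => ψ x + φ x) where
  ac := hψ.ac.add hφ.ac
  differentiable := hψ.differentiable.fun_add hφ.differentiable
  ac_quasiDeriv := (hψ.ac_quasiDeriv.add hφ.ac_quasiDeriv).congr (quasiDeriv_add hψ hφ)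
  memLp := hψ.memLp.add hφ.memLp
  memLp_L := (memLp_congr_ae (L_add hψ hφ)).1 (hψ.memLp_L.add hφ.memLp_L)

lemma MemMaxOn.smul (k : ℂ) (hψ : MemMaxOn a l r ψ) : MemMaxOn a l r (fun x => k * ψ x) where
  ac := hψ.ac.smul k
  differentiable := hψ.differentiable.const_mul k
  ac_quasiDeriv := by rw [quasiDeriv_smul]; exact hψ.ac_quasiDeriv.smul k
  memLp := hψ.memLp.const_mul k
  memLp_L := by rw [L_smul]; exact hψ.memLp_L.const_mul k

lemma lagrange_add (hψ : MemMaxOn a l r ψ) (hφ : MemMaxOn a l r φ) (g : ℝ → ℂ) :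
    EqOn (fun x => lagrange a ψ g x + lagrange a φ g x)
      (lagrange a (fun x => ψ x + φ x) g) (Ioo l r) := by
  intro x hx
  simp only [lagrange]
  rw [← quasiDeriv_add hψ hφ hx]
  ring

lemma lagrange_smul (k : ℂ) (ψ g : ℝ → ℂ) :
    lagrange a (fun x => k * ψ x) g = fun x => k * lagrange a ψ g x := by
  funext x
  simp only [lagrange, quasiDeriv_smul]
  ring

/-- Two functions with the same values on `(a₂, a₃)` and on `(a₃, a₄)` up to null sets agree
almost everywhere on `(a₂, a₄)`. -/
lemma ae_of_ae_of_ae {p : ℝ → Prop}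
    (h1 : ∀ᵐ x ∂(volume.restrict (Ioo (a 1) (a 2))), p x)
    (h2 : ∀ᵐ x ∂(volume.restrict (Ioo (a 2) (a 3))), p x) :
    ∀ᵐ x ∂(volume.restrict (Ioo (a 1) (a 3))), p x := by
  rw [ae_restrict_iff' measurableSet_Ioo] at h1 h2 ⊢
  have h3 : ∀ᵐ x : ℝ, x ≠ a 2 := by simp [ae_iff]
  filter_upwards [h1, h2, h3] with x hx1 hx2 hx3 hx
  rcases lt_or_gt_of_ne hx3 with h | h
  · exact hx1 ⟨hx.1, h⟩
  · exact hx2 ⟨h, hx.2⟩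

lemma L_add_ae (hψ : MemMax a ψ) (hφ : MemMax a φ) :
    (fun x => L a ψ x + L a φ x) =ᵐ[volume.restrict (Ioo (a 1) (a 3))]
      L a (fun x => ψ x + φ x) :=
  ae_of_ae_of_ae (L_add hψ.1 hφ.1) (L_add hψ.2 hφ.2)

lemma MemDomain.add (ha : StrictMono a) (hψ : MemDomain a ψ) (hφ : MemDomain a φ) :
    MemDomain a (fun x => ψ x + φ x) := by
  have h12 : a 1 < a 2 := ha (by decide)
  have h23 : a 2 < a 3 := ha (by decide)
  have e1 (g : ℝ → ℂ) := lagrange_add hψ.mem_max.1 hφ.mem_max.1 g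
  have e2 (g : ℝ → ℂ) := lagrange_add hψ.mem_max.2 hφ.mem_max.2 g
  obtain ⟨c, hc1, hc2⟩ := hψ.trans_u
  obtain ⟨d, hd1, hd2⟩ := hφ.trans_u
  obtain ⟨c', hc1', hc2'⟩ := hψ.trans_v
  obtain ⟨d', hd1', hd2'⟩ := hφ.trans_v
  refine ⟨⟨hψ.mem_max.1.add hφ.mem_max.1, hψ.mem_max.2.add hφ.mem_max.2⟩, ?_, ?_,
    ⟨c + d, ?_, ?_⟩, ⟨c' + d', ?_, ?_⟩⟩
  · have := hψ.bc_left.add hφ.bc_left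
    rw [add_zero] at this
    exact this.congr' ((e1 u).eventuallyEq_of_mem (Ioo_mem_nhdsGT h12))
  · have := hψ.bc_right.add hφ.bc_right
    rw [add_zero] at this
    exact this.congr' ((e2 u).eventuallyEq_of_mem (Ioo_mem_nhdsLT h23))
  · exact (hc1.add hd1).congr' ((e1 u).eventuallyEq_of_mem (Ioo_mem_nhdsLT h12))
  · exact (hc2.add hd2).congr' ((e2 u).eventuallyEq_of_mem (Ioo_mem_nhdsGT h23))
  · exact (hc1'.add hd1').congr' ((e1 (v a)).eventuallyEq_of_mem (Ioo_mem_nhdsLT h12))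
  · exact (hc2'.add hd2').congr' ((e2 (v a)).eventuallyEq_of_mem (Ioo_mem_nhdsGT h23))

lemma MemDomain.smul (k : ℂ) (hψ : MemDomain a ψ) : MemDomain a (fun x => k * ψ x) := by
  obtain ⟨c, hc1, hc2⟩ := hψ.trans_u
  obtain ⟨d, hd1, hd2⟩ := hψ.trans_v
  refine ⟨⟨hψ.mem_max.1.smul k, hψ.mem_max.2.smul k⟩, ?_, ?_, ⟨k * c, ?_, ?_⟩,
    ⟨k * d, ?_, ?_⟩⟩ <;> rw [lagrange_smul]
  · simpa using hψ.bc_left.const_mul k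
  · simpa using hψ.bc_right.const_mul k
  · exact hc1.const_mul k
  · exact hc2.const_mul k
  · exact hd1.const_mul k
  · exact hd2.const_mul k

lemma L_zero : L a (fun _ => 0) = fun _ => 0 := by
  simpa using L_smul (a := a) 0 (fun _ => 0)

lemma MemDomain.zero : MemDomain a (fun _ => 0) := by
  have hq : quasiDeriv a (fun _ => 0) = fun _ => 0 := by
    funext x; simp [quasiDeriv]
  have hl (g : ℝ → ℂ) : lagrange a (fun _ => 0) g = fun _ => 0 := by
    funext x; simp [lagrange, hq]
  have hac (l r : ℝ) : ACLoc (fun _ => 0) l r := by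
    intro c _ d _
    simpa [AbsolutelyContinuousOnInterval] using tendsto_const_nhds
  have hm (l r : ℝ) : MemMaxOn a l r (fun _ => 0) :=
    ⟨hac l r, differentiableOn_const _, by rw [hq]; exact hac l r, MemLp.zero',
      by rw [L_zero]; exact MemLp.zero'⟩
  refine ⟨⟨hm _ _, hm _ _⟩, ?_, ?_, ⟨0, ?_, ?_⟩, ⟨0, ?_, ?_⟩⟩ <;>
    rw [hl] <;> exact tendsto_const_nhds

end linearity

/-! ### The operator -/

/-- The graph of `L_S` in `L²(a₂, a₄) × L²(a₂, a₄)`: all pairs of classes `(ψ, L ψ)` where `ψ`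
runs through the domain functions. -/
def graphLS (a : Fin 4 → ℝ) (ha : StrictMono a) : Submodule ℂ (H a × H a) where
  carrier := {p | ∃ ψ : ℝ → ℂ, MemDomain a ψ ∧
    p.1 =ᵐ[volume.restrict (Ioo (a 1) (a 3))] ψ ∧
    p.2 =ᵐ[volume.restrict (Ioo (a 1) (a 3))] L a ψ}
  zero_mem' := by
    refine ⟨fun _ => 0, MemDomain.zero, Lp.coeFn_zero _ _ _, ?_⟩
    rw [L_zero]
    exact Lp.coeFn_zero _ _ _
  add_mem' := by
    rintro p q ⟨ψ, hψ, hp1, hp2⟩ ⟨φ, hφ, hq1, hq2⟩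
    refine ⟨fun x => ψ x + φ x, hψ.add ha hφ, ?_, ?_⟩
    · exact (Lp.coeFn_add _ _).trans (hp1.add hq1)
    · exact (Lp.coeFn_add _ _).trans ((hp2.add hq2).trans (L_add_ae hψ.mem_max hφ.mem_max))
  smul_mem' := by
    rintro k p ⟨ψ, hψ, hp1, hp2⟩
    refine ⟨fun x => k * ψ x, hψ.smul k, ?_, ?_⟩
    · exact (Lp.coeFn_smul _ _).trans (hp1.const_smul k)
    · rw [L_smul]
      exact (Lp.coeFn_smul _ _).trans (hp2.const_smul k)

/-- The operator `L_S : D(L_S) → L²(a₂, a₄)`, `ψ ↦ L ψ`, as a partially defined linear operator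
in `L²(a₂, a₄)`; see `mem_domain_LS` and `LS_apply`. -/
def LS (a : Fin 4 → ℝ) (ha : StrictMono a) : H a →ₗ.[ℂ] H a := (graphLS a ha).toLinearPMap

section operator

variable {a : Fin 4 → ℝ} {ψ : ℝ → ℂ}

lemma L_eqOn_zero {l r : ℝ} (hψ : MemMaxOn a l r ψ)
    (h0 : ψ =ᵐ[volume.restrict (Ioo l r)] fun _ => 0) : EqOn (L a ψ) (fun _ => 0) (Ioo l r) := by
  have e0 : EqOn ψ (fun _ => 0) (Ioo l r) :=
    Measure.eqOn_open_of_ae_eq h0 isOpen_Ioo hψ.differentiable.continuousOn continuousOn_const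
  have e1 : EqOn (quasiDeriv a ψ) (fun _ => 0) (Ioo l r) := by
    intro x hx
    have := (e0.eventuallyEq_of_mem (Ioo_mem_nhds hx.1 hx.2)).deriv_eq
    simp [quasiDeriv, this]
  intro x hx
  have := (e1.eventuallyEq_of_mem (Ioo_mem_nhds hx.1 hx.2)).deriv_eq
  simp [L, this, e0 hx]

lemma graphLS_single_valued (ha : StrictMono a) :
    ∀ p ∈ graphLS a ha, p.1 = 0 → p.2 = 0 := by
  rintro p ⟨ψ, hψ, h1, h2⟩ h0
  have h12 : a 1 < a 2 := ha (by decide)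
  have h23 : a 2 < a 3 := ha (by decide)
  have hz : ψ =ᵐ[volume.restrict (Ioo (a 1) (a 3))] fun _ => 0 := by
    rw [h0] at h1
    exact h1.symm.trans (Lp.coeFn_zero _ _ _)
  have z1 := L_eqOn_zero hψ.mem_max.1
    (ae_restrict_of_ae_restrict_of_subset (Ioo_subset_Ioo_right h23.le) hz)
  have z2 := L_eqOn_zero hψ.mem_max.2
    (ae_restrict_of_ae_restrict_of_subset (Ioo_subset_Ioo_left h12.le) hz)
  have hL : L a ψ =ᵐ[volume.restrict (Ioo (a 1) (a 3))] fun _ => 0 :=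
    ae_of_ae_of_ae (ae_restrict_of_forall_mem measurableSet_Ioo z1)
      (ae_restrict_of_forall_mem measurableSet_Ioo z2)
  exact Lp.ext ((h2.trans hL).trans (Lp.coeFn_zero _ _ _).symm)

lemma graph_LS (ha : StrictMono a) : (LS a ha).graph = graphLS a ha :=
  Submodule.toLinearPMap_graph_eq _ (fun x hx h => graphLS_single_valued ha x hx h)

lemma memLp_of_memLp {f : ℝ → ℂ}
    (h1 : MemLp f 2 (volume.restrict (Ioo (a 1) (a 2))))
    (h2 : MemLp f 2 (volume.restrict (Ioo (a 2) (a 3)))) :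
    MemLp f 2 (volume.restrict (Ioo (a 1) (a 3))) := by
  have hsub : Ioo (a 1) (a 3) ≤ᵐ[volume] (Ioo (a 1) (a 2) ∪ Ioo (a 2) (a 3) : Set ℝ) := by
    have h3 : ∀ᵐ x : ℝ, x ≠ a 2 := by simp [ae_iff]
    filter_upwards [h3] with x hx hxm
    rcases lt_or_gt_of_ne hx with h | h
    · exact Or.inl ⟨hxm.1, h⟩
    · exact Or.inr ⟨h, hxm.2⟩
  have hU : MemLp f 2 (volume.restrict (Ioo (a 1) (a 2) ∪ Ioo (a 2) (a 3))) := by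
    have hm := aestronglyMeasurable_union_iff.2 ⟨h1.1, h2.1⟩
    refine (memLp_two_iff_integrable_sq_norm hm).2 ?_
    exact IntegrableOn.union ((memLp_two_iff_integrable_sq_norm h1.1).1 h1)
      ((memLp_two_iff_integrable_sq_norm h2.1).1 h2)
  exact hU.mono_measure (Measure.restrict_mono' hsub le_rfl)

/-- The domain of `L_S` consists of the classes of the domain functions. -/
theorem mem_domain_LS (ha : StrictMono a) (f : H a) :
    f ∈ (LS a ha).domain ↔
      ∃ ψ : ℝ → ℂ, MemDomain a ψ ∧ f =ᵐ[volume.restrict (Ioo (a 1) (a 3))] ψ := by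
  rw [LinearPMap.mem_domain_iff, graph_LS]
  constructor
  · rintro ⟨g, ψ, hψ, h1, -⟩
    exact ⟨ψ, hψ, h1⟩
  · rintro ⟨ψ, hψ, h1⟩
    have hL := memLp_of_memLp hψ.mem_max.1.memLp_L hψ.mem_max.2.memLp_L
    exact ⟨hL.toLp _, ψ, hψ, h1, hL.coeFn_toLp⟩

/-- `L_S` maps the class of a domain function `ψ` to the class of `L ψ`. -/
theorem LS_apply (ha : StrictMono a) (f : (LS a ha).domain) (hψ : MemDomain a ψ)
    (hf : (f : H a) =ᵐ[volume.restrict (Ioo (a 1) (a 3))] ψ) :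
    LS a ha f =ᵐ[volume.restrict (Ioo (a 1) (a 3))] L a ψ := by
  let g : H a := (memLp_of_memLp hψ.mem_max.1.memLp_L hψ.mem_max.2.memLp_L).toLp _
  have hg : g =ᵐ[volume.restrict (Ioo (a 1) (a 3))] L a ψ := MemLp.coeFn_toLp _
  have hm : ((f : H a), g) ∈ (LS a ha).graph := by
    rw [graph_LS]
    exact ⟨ψ, hψ, hf, hg⟩
  obtain ⟨y, hy1, hy2⟩ := (LinearPMap.mem_graph_iff _).1 hm
  have : y = f := Subtype.ext hy1
  subst this
  rw [hy2]
  exact hg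

end operator

/-! ### Eigenvalues of partially defined operators -/

/-- The eigenspace `{x ∈ D(T) : T x = c x}` of a partially defined operator `T`. -/
def eigenspace {E : Type*} [AddCommGroup E] [Module ℂ E] (T : E →ₗ.[ℂ] E) (c : ℂ) :
    Submodule ℂ E where
  carrier := {x | ∃ h : x ∈ T.domain, T ⟨x, h⟩ = c • x}
  zero_mem' := ⟨T.domain.zero_mem, by
    rw [smul_zero]; exact T.map_zero⟩
  add_mem' := by
    rintro x y ⟨hx, hx'⟩ ⟨hy, hy'⟩
    refine ⟨T.domain.add_mem hx hy, ?_⟩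
    rw [smul_add, ← hx', ← hy']
    exact T.map_add ⟨x, hx⟩ ⟨y, hy⟩
  smul_mem' := by
    rintro k x ⟨hx, hx'⟩
    refine ⟨T.domain.smul_mem k hx, ?_⟩
    rw [smul_comm, ← hx']
    exact T.map_smul k ⟨x, hx⟩

/-- `c` is an eigenvalue of `T` if `T x = c x` for some nonzero `x ∈ D(T)`. -/
def IsEigenvalue {E : Type*} [AddCommGroup E] [Module ℂ E] (T : E →ₗ.[ℂ] E) (c : ℂ) : Prop :=
  ∃ x : T.domain, (x : E) ≠ 0 ∧ T x = c • (x : E)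

end SingularSL

end

noncomputable section
namespace SingularSL

/-! Since `P v' = 1`, the quantities `A = P ψ' = -[ψ, u]` and `B = [ψ, v] = ψ - v P ψ'` determine `ψ
= B + v A`, and `L ψ = c ψ` becomes `A' = g (B + v A)`, `B' = -v g (B + v A)` with `g = c - 2 (x -
σ)²`. The singularities of `v` are logarithmic, so `v²` is integrable and this system is regular up
to the points `aᵢ`: `B` has an endpoint limit (`MemMaxOn.exists_tendsto_lagrange_v`), and zero
endpoint values force the zero solution (`system_eqOn_zero`).

An eigenfunction has `A(a₂⁺) = 0` by the boundary condition. If also `B(a₂⁺) = 0`, it vanishes on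
the first interval; the transmission conditions carry zero data across `a₃`, so it vanishes on the
second (`MemDomain.ae_eq_zero`). Hence the linear functional `ψ ↦ [ψ, v](a₂⁺)` is injective on the
eigenspace, whose dimension is at most one. -/

/-! ### Integrability and regularity tools -/

lemma intervalIntegrable_log_sq (l r : ℝ) :
    IntervalIntegrable (fun x => Real.log x ^ 2) volume l r := by
  refine intervalIntegrable_of_even (fun x => by rw [Real.log_neg_eq_log]) fun x hx => ?_
  -- The primitive is `x log² x - 2 x log x + 2 x`; writing `x log² x` as `(2 √x log √x)²` makes
  -- continuity at `0` follow from that of `x log x`.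
  refine intervalIntegral.intervalIntegrable_deriv_of_nonneg
    (g := fun x => (2 * (√x * Real.log √x)) ^ 2 - 2 * (x * Real.log x) + 2 * x) ?_ ?_ ?_
  · exact ((((Real.continuous_mul_log.comp Real.continuous_sqrt).const_mul 2).pow 2).sub
      (Real.continuous_mul_log.const_mul 2)).add (continuous_id.const_mul 2) |>.continuousOn
  · intro s hs
    have hs0 : 0 < s := by simpa [hx.le] using hs.1
    have h1 : HasDerivAt (fun x => x * Real.log x ^ 2 - 2 * (x * Real.log x) + 2 * x)
        (Real.log s ^ 2) s := by
      have hl := Real.hasDerivAt_log hs0.ne'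
      refine ((((hasDerivAt_id s).mul (hl.pow 2)).sub
        (((hasDerivAt_id s).mul hl).const_mul 2)).add
        ((hasDerivAt_id s).const_mul 2)).congr_deriv ?_
      simp only [id, Pi.pow_apply]
      field_simp
      ring
    refine h1.congr_of_eventuallyEq ?_
    filter_upwards [lt_mem_nhds hs0] with y hy
    rw [Real.log_sqrt hy.le]
    linear_combination Real.log y ^ 2 * Real.sq_sqrt hy.le
  · exact fun s _ => sq_nonneg _

/-- A locally absolutely continuous function whose derivative agrees almost everywhere with a
continuous function is continuously differentiable. -/
lemma ACLoc.hasDerivAt {f g : ℝ → ℂ} {l r : ℝ} (hf : ACLoc f l r)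
    (hg : ContinuousOn g (Ioo l r)) (h : deriv f =ᵐ[volume.restrict (Ioo l r)] g) {x : ℝ}
    (hx : x ∈ Ioo l r) : HasDerivAt f (g x) x := by
  obtain ⟨c, hc, hcx⟩ := exists_between hx.1
  obtain ⟨d, hxd, hd⟩ := exists_between hx.2
  have hcd : c < d := hcx.trans hxd
  have hsub : uIcc c d ⊆ Ioo l r := by
    rw [uIcc_of_le hcd.le]
    exact Icc_subset_Ioo hc hd
  have hG : ∀ y ∈ Ioo l r, HasDerivAt (fun z => ∫ t in c..z, g t) (g y) y := by
    intro y hy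
    have hcy : uIcc c y ⊆ Ioo l r := ordConnected_Ioo.uIcc_subset ⟨hc, hcd.trans hd⟩ hy
    exact intervalIntegral.integral_hasDerivAt_right (hg.mono hcy).intervalIntegrable
      (hg.stronglyMeasurableAtFilter isOpen_Ioo y hy)
      (hg.continuousAt (Ioo_mem_nhds hy.1 hy.2))
  obtain ⟨C, hC⟩ := isCompact_uIcc.exists_bound_of_continuousOn (hg.mono hsub)
  have hlip : LipschitzOnWith C.toNNReal (fun z => ∫ t in c..z, g t) (uIcc c d) := by
    refine (convex_uIcc c d).lipschitzOnWith_of_nnnorm_hasDerivWithin_le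
      (fun y hy => (hG y (hsub hy)).hasDerivWithinAt) fun y hy => ?_
    exact NNReal.le_toNNReal_of_coe_le (hC y hy)
  -- The difference of `f` and the primitive of `g` is absolutely continuous with derivative zero
  -- almost everywhere, hence constant near `x`.
  have hac := (hf c ⟨hc, hcd.trans hd⟩ d ⟨hc.trans hcd, hd⟩).sub
    hlip.absolutelyContinuousOnInterval
  obtain ⟨k, hk⟩ := hac.const_of_ae_hasDerivAt_zero (by
    have h1 := hf.ae_differentiableAt
    rw [ae_restrict_iff' measurableSet_Ioo] at h1
    rw [EventuallyEq, ae_restrict_iff' measurableSet_Ioo] at h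
    filter_upwards [h1, h] with y hy1 hy2 hy
    have h3 := (hy1 (hsub hy)).hasDerivAt.sub (hG y (hsub hy))
    rwa [hy2 (hsub hy), sub_self] at h3)
  refine ((hG x hx).add_const k).congr_of_eventuallyEq ?_
  filter_upwards [Icc_mem_nhds hcx hxd] with y hy
  have := hk y (by rwa [uIcc_of_le hcd.le])
  simp only [Pi.sub_apply] at this
  rw [← this]
  ring

/-! ### Grönwall uniqueness from a singular endpoint -/

/-- Uniqueness for the system `A' = g (B + w A)`, `B' = - w g (B + w A)` with vanishing initial
values at a singular left endpoint. -/
lemma system_eqOn_zero {l r K : ℝ} {A B g : ℝ → ℂ} {w : ℝ → ℝ}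
    (hK : ∀ x ∈ Ioo l r, ‖g x‖ ≤ K) (hw : ContinuousOn w (Ioo l r))
    (hw2 : IntegrableOn (fun x => w x ^ 2) (Ioo l r))
    (hA : ∀ x ∈ Ioo l r, HasDerivAt A (g x * (B x + w x * A x)) x)
    (hB : ∀ x ∈ Ioo l r, HasDerivAt B (-(w x * g x * (B x + w x * A x))) x)
    (hA0 : Tendsto A (𝓝[>] l) (𝓝 0)) (hB0 : Tendsto B (𝓝[>] l) (𝓝 0)) :
    ∀ x ∈ Ioo l r, A x = 0 ∧ B x = 0 := by
  intro x hx
  have hK0 : 0 ≤ K := (norm_nonneg _).trans (hK x hx)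
  -- Grönwall weight for `E = ‖A‖² + ‖B‖²`: Cauchy–Schwarz and `b7` give `E' ≤ m E`, and `m` is
  -- integrable up to `l` because `w²` is.
  set m : ℝ → ℝ := fun t => 2 * K * (1 + w t ^ 2) with hm
  have hmc : ContinuousOn m (Ioo l r) := (continuousOn_const.add (hw.pow 2)).const_smul (2 * K)
  have hmi : IntegrableOn m (Ioo l r) :=
    ((integrableOn_const (by simp)).add hw2).const_mul (2 * K)
  have hM : ∀ y ∈ Ioo l r, HasDerivAt (fun z => ∫ t in l..z, m t) (m y) y := by
    intro y hy
    refine intervalIntegral.integral_hasDerivAt_right ?_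
      (hmc.stronglyMeasurableAtFilter isOpen_Ioo y hy)
      (hmc.continuousAt (Ioo_mem_nhds hy.1 hy.2))
    rw [intervalIntegrable_iff_integrableOn_Ioo_of_le hy.1.le]
    exact hmi.mono_set (Ioo_subset_Ioo_right hy.2.le)
  have hM0 : ∀ y ∈ Ioo l r, 0 ≤ ∫ t in l..y, m t := fun y hy =>
    intervalIntegral.integral_nonneg hy.1.le fun t _ => by positivity
  set E : ℝ → ℝ := fun t => ‖A t‖ ^ 2 + ‖B t‖ ^ 2 with hE
  have hF : ∀ y ∈ Ioo l r, ∃ e ≤ 0,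
      HasDerivAt (fun z => E z * Real.exp (-∫ t in l..z, m t)) e y := by
    intro y hy
    have h1 := (hA y hy).norm_sq.add (hB y hy).norm_sq
    have h2 := h1.mul (hM y hy).neg.exp
    refine ⟨_, ?_, h2⟩
    have b1 := (le_abs_self _).trans (abs_real_inner_le_norm (A y) (g y * (B y + w y * A y)))
    have b2 := (le_abs_self _).trans
      (abs_real_inner_le_norm (B y) (-(w y * g y * (B y + w y * A y))))
    have b3 : ‖B y + w y * A y‖ ≤ ‖B y‖ + |w y| * ‖A y‖ := by
      refine (norm_add_le _ _).trans ?_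
      rw [norm_mul, Complex.norm_real, Real.norm_eq_abs]
    rw [norm_mul] at b1
    rw [norm_neg, norm_mul, norm_mul, Complex.norm_real, Real.norm_eq_abs] at b2
    have b4 : ‖g y‖ * ‖B y + w y * A y‖ ≤ K * (‖B y‖ + |w y| * ‖A y‖) :=
      mul_le_mul (hK y hy) b3 (norm_nonneg _) hK0
    have b5 := mul_le_mul_of_nonneg_left b4 (norm_nonneg (A y))
    have b6 := mul_le_mul_of_nonneg_left b4
      (mul_nonneg (norm_nonneg (B y)) (abs_nonneg (w y)))
    have b7 : (‖A y‖ + ‖B y‖ * |w y|) * (‖B y‖ + |w y| * ‖A y‖)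
        ≤ (1 + w y ^ 2) * (‖A y‖ ^ 2 + ‖B y‖ ^ 2) := by
      rw [← sq_abs (w y)]
      nlinarith [mul_nonneg (add_nonneg zero_le_one (sq_nonneg |w y|)) (sq_nonneg (‖A y‖ - ‖B y‖)),
        mul_nonneg (add_nonneg (sq_nonneg ‖A y‖) (sq_nonneg ‖B y‖)) (sq_nonneg (|w y| - 1))]
    have b8 := mul_le_mul_of_nonneg_left b7 hK0
    have b9 : 2 * inner ℝ (A y) (g y * (B y + w y * A y))
        + 2 * inner ℝ (B y) (-(w y * g y * (B y + w y * A y))) - m y * E y ≤ 0 := by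
      simp only [hm, hE]
      linarith
    have b10 := mul_nonpos_of_nonpos_of_nonneg b9 (Real.exp_pos (-∫ t in l..y, m t)).le
    refine le_of_eq_of_le ?_ b10
    simp only [hE, Pi.add_apply, Pi.neg_apply]
    ring
  choose! e he0 he using hF
  have hanti : AntitoneOn (fun z => E z * Real.exp (-∫ t in l..z, m t)) (Ioo l r) := by
    refine antitoneOn_of_hasDerivWithinAt_nonpos (convex_Ioo l r)
      (fun y hy => (he y hy).continuousAt.continuousWithinAt) (f' := e) ?_ ?_ <;>
      rw [interior_Ioo]
    · exact fun y hy => (he y hy).hasDerivWithinAt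
    · exact he0
  have hlim : Tendsto E (𝓝[>] l) (𝓝 0) := by
    simpa using (hA0.norm.pow 2).add (hB0.norm.pow 2)
  -- By monotonicity the value at `x` is at most `E y` for every `y` between `l` and `x`, and `E y →
  -- 0` as `y → l`.
  have hle : E x * Real.exp (-∫ t in l..x, m t) ≤ 0 := by
    refine ge_of_tendsto hlim ?_
    filter_upwards [Ioo_mem_nhdsGT hx.1] with y hy
    have hy' : y ∈ Ioo l r := ⟨hy.1, hy.2.trans hx.2⟩
    refine (hanti hy' hx hy.2.le).trans (mul_le_of_le_one_right (by positivity) ?_)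
    exact Real.exp_le_one_iff.2 (neg_nonpos.2 (hM0 y hy'))
  have hEx : E x ≤ 0 := nonpos_of_mul_nonpos_left hle (Real.exp_pos _)
  simp only [hE] at hEx
  have ha := sq_nonneg ‖A x‖
  have hb := sq_nonneg ‖B x‖
  exact ⟨norm_eq_zero.1 (pow_eq_zero_iff two_ne_zero |>.1 (by linarith)),
    norm_eq_zero.1 (pow_eq_zero_iff two_ne_zero |>.1 (by linarith))⟩

/-! ### The logarithmic function `v` -/

/-- The real-valued function underlying `v`. -/
def vReal (a : Fin 4 → ℝ) (y : ℝ) : ℝ :=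
  ∑ i, (∏ j ∈ Finset.univ.erase i, 1 / (a i - a j)) * Real.log |y - a i|

variable {a : Fin 4 → ℝ} {l r : ℝ} {ψ : ℝ → ℂ} {c : ℂ}

lemma v_eq_ofReal (a : Fin 4 → ℝ) : v a = fun y => (vReal a y : ℂ) := rfl

lemma P_ne_zero {x : ℝ} (hx : ∀ i, x ≠ a i) : P a x ≠ 0 :=
  Finset.prod_ne_zero_iff.2 fun i _ => sub_ne_zero.2 (hx i)

/-- Partial fractions of `1 / P`, read off from the barycentric form of Lagrange interpolation of
the constant `1` at the nodes `aᵢ`. -/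
lemma sum_inv_eq_inv_P (ha : StrictMono a) {x : ℝ} (hx : ∀ i, x ≠ a i) :
    ∑ i, (∏ j ∈ Finset.univ.erase i, 1 / (a i - a j)) * (x - a i)⁻¹ = (P a x)⁻¹ := by
  have h := Lagrange.eval_interpolate_not_at_node (s := Finset.univ) (v := a) (x := x) 1
    fun i _ => hx i
  rw [Lagrange.interpolate_one ha.injective.injOn Finset.univ_nonempty, Polynomial.eval_one,
    Lagrange.eval_nodal] at h
  refine eq_inv_of_mul_eq_one_right ?_
  rw [eq_comm] at h
  simpa only [Lagrange.nodalWeight, Pi.one_apply, mul_one, one_div, P] using h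

/-- This is `P v' = 1`: together with `u`, the function `v` spans the solutions of `(P y')' = 0` on
each interval free of the `aᵢ`. -/
lemma hasDerivAt_vReal (ha : StrictMono a) {x : ℝ} (hx : ∀ i, x ≠ a i) :
    HasDerivAt (vReal a) (P a x)⁻¹ x := by
  rw [← sum_inv_eq_inv_P ha hx]
  refine HasDerivAt.fun_sum fun i _ => HasDerivAt.const_mul _ ?_
  simp only [Real.log_abs]
  simpa using ((hasDerivAt_id x).sub_const (a i)).log (sub_ne_zero.2 (hx i))

lemma memLp_log_abs_sub (b l r : ℝ) :
    MemLp (fun x => Real.log |x - b|) 2 (volume.restrict (Ioo l r)) := by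
  simp only [Real.log_abs]
  have hm : Measurable fun x => Real.log (x - b) :=
    Real.measurable_log.comp (measurable_id.sub_const b)
  rw [memLp_two_iff_integrable_sq hm.aestronglyMeasurable]
  rcases lt_or_ge l r with h | h
  · have := (intervalIntegrable_log_sq (l - b) (r - b)).comp_sub_right b
    simp only [sub_add_cancel] at this
    exact (intervalIntegrable_iff_integrableOn_Ioo_of_le h.le).1 this
  · simp [Ioo_eq_empty_of_le h]

lemma memLp_vReal (a : Fin 4 → ℝ) (l r : ℝ) :
    MemLp (vReal a) 2 (volume.restrict (Ioo l r)) :=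
  memLp_finsetSum _ fun i _ => (memLp_log_abs_sub (a i) l r).const_mul _

lemma lagrange_u (a : Fin 4 → ℝ) (ψ : ℝ → ℂ) :
    lagrange a ψ u = fun x => -quasiDeriv a ψ x := by
  funext x
  simp [lagrange, u, quasiDeriv]

lemma lagrange_v (ha : StrictMono a) {x : ℝ} (hx : ∀ i, x ≠ a i) :
    lagrange a ψ (v a) x = ψ x - vReal a x * quasiDeriv a ψ x := by
  have h1 : (fun y => star (v a y)) = fun y => (vReal a y : ℂ) := by
    funext y
    simp [v_eq_ofReal]
  have h2 : quasiDeriv a (fun y => star (v a y)) x = 1 := by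
    rw [h1, quasiDeriv, (hasDerivAt_vReal ha hx).ofReal_comp.deriv, ← Complex.ofReal_mul,
      mul_inv_cancel₀ (P_ne_zero hx), Complex.ofReal_one]
  rw [lagrange, h2, congrFun h1 x, mul_one]

/-! ### The eigenvalue equation as a first-order system -/

/-- The coefficient `g` in `(P ψ')' = g ψ`, the form taken by `L ψ = c ψ`. -/
def coeff (a : Fin 4 → ℝ) (c : ℂ) (x : ℝ) : ℂ := c - ((2 * (x - sigma a) ^ 2 : ℝ) : ℂ)

lemma continuous_coeff (a : Fin 4 → ℝ) (c : ℂ) : Continuous (coeff a c) := by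
  unfold coeff
  fun_prop

lemma exists_norm_coeff_le (a : Fin 4 → ℝ) (c : ℂ) (l r : ℝ) :
    ∃ K, ∀ x ∈ Ioo l r, ‖coeff a c x‖ ≤ K := by
  obtain ⟨K, hK⟩ :=
    isCompact_Icc.exists_bound_of_continuousOn (continuous_coeff a c).continuousOn (s := Icc l r)
  exact ⟨K, fun x hx => hK x (Ioo_subset_Icc_self hx)⟩

/-- The equation is known only almost everywhere, but its right-hand side is continuous, so
`ACLoc.hasDerivAt` upgrades it to every point. -/
lemma MemMaxOn.hasDerivAt_quasiDeriv (hψ : MemMaxOn a l r ψ)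
    (hL : L a ψ =ᵐ[volume.restrict (Ioo l r)] fun x => c * ψ x) {x : ℝ} (hx : x ∈ Ioo l r) :
    HasDerivAt (quasiDeriv a ψ) (coeff a c x * ψ x) x := by
  refine hψ.ac_quasiDeriv.hasDerivAt (g := fun x => coeff a c x * ψ x)
    ((continuous_coeff a c).continuousOn.mul hψ.differentiable.continuousOn) ?_ hx
  filter_upwards [hL] with y hy
  simp only [L] at hy
  rw [coeff]
  linear_combination hy

/-- In differentiating `ψ - v P ψ'`, the terms `ψ'` and `v' P ψ'` cancel because `P v' = 1`; only
`-v (P ψ')'` remains. -/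
lemma MemMaxOn.hasDerivAt_lagrange_v (ha : StrictMono a) (hψ : MemMaxOn a l r ψ)
    (hne : ∀ x ∈ Ioo l r, ∀ i, x ≠ a i)
    (hL : L a ψ =ᵐ[volume.restrict (Ioo l r)] fun x => c * ψ x) {x : ℝ} (hx : x ∈ Ioo l r) :
    HasDerivAt (lagrange a ψ (v a)) (-(vReal a x * coeff a c x * ψ x)) x := by
  have h1 := (hψ.differentiableAt hx).hasDerivAt.sub
    ((hasDerivAt_vReal ha (hne x hx)).ofReal_comp.mul (hψ.hasDerivAt_quasiDeriv hL hx))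
  have h2 := h1.congr_of_eventuallyEq (f₁ := lagrange a ψ (v a)) <|
    eventually_of_mem (Ioo_mem_nhds hx.1 hx.2) fun y hy => lagrange_v ha (hne y hy)
  refine h2.congr_deriv ?_
  have hP : (P a x : ℂ) ≠ 0 := Complex.ofReal_ne_zero.2 (P_ne_zero (hne x hx))
  simp only [quasiDeriv, Complex.ofReal_inv]
  field_simp
  ring

/-- A solution of `L ψ = c ψ` on an interval without singular points is zero if `[ψ, u]` and
`[ψ, v]` vanish at the left endpoint. -/
lemma MemMaxOn.eqOn_zero (ha : StrictMono a) (hψ : MemMaxOn a l r ψ)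
    (hne : ∀ x ∈ Ioo l r, ∀ i, x ≠ a i)
    (hL : L a ψ =ᵐ[volume.restrict (Ioo l r)] fun x => c * ψ x)
    (hu : Tendsto (lagrange a ψ u) (𝓝[>] l) (𝓝 0))
    (hv : Tendsto (lagrange a ψ (v a)) (𝓝[>] l) (𝓝 0)) :
    EqOn (quasiDeriv a ψ) 0 (Ioo l r) ∧ EqOn ψ 0 (Ioo l r) := by
  obtain ⟨K, hK⟩ := exists_norm_coeff_le a c l r
  have he : ∀ x ∈ Ioo l r, lagrange a ψ (v a) x + vReal a x * quasiDeriv a ψ x = ψ x := by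
    intro x hx
    rw [lagrange_v ha (hne x hx), sub_add_cancel]
  have hA0 : Tendsto (quasiDeriv a ψ) (𝓝[>] l) (𝓝 0) := by
    rw [lagrange_u] at hu
    simpa using hu.neg
  have key := system_eqOn_zero (A := quasiDeriv a ψ) (B := lagrange a ψ (v a)) hK
    (fun x hx => (hasDerivAt_vReal ha (hne x hx)).continuousAt.continuousWithinAt)
    (memLp_vReal a l r).integrable_sq
    (fun x hx => by rw [he x hx]; exact hψ.hasDerivAt_quasiDeriv hL hx)
    (fun x hx => by rw [he x hx]; exact hψ.hasDerivAt_lagrange_v ha hne hL hx) hA0 hv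
  refine ⟨fun x hx => (key x hx).1, fun x hx => ?_⟩
  rw [← he x hx, (key x hx).1, (key x hx).2]
  simp

/-- For a solution of `L ψ = c ψ`, the form `[ψ, v]` has a limit at the left endpoint. -/
lemma MemMaxOn.exists_tendsto_lagrange_v (ha : StrictMono a) (hlr : l < r)
    (hψ : MemMaxOn a l r ψ) (hne : ∀ x ∈ Ioo l r, ∀ i, x ≠ a i)
    (hL : L a ψ =ᵐ[volume.restrict (Ioo l r)] fun x => c * ψ x) :
    ∃ b, Tendsto (lagrange a ψ (v a)) (𝓝[>] l) (𝓝 b) := by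
  obtain ⟨K, hK⟩ := exists_norm_coeff_le a c l r
  set f : ℝ → ℂ := fun x => -(vReal a x * coeff a c x * ψ x)
  -- The derivative of `[ψ, v]` is a bounded coefficient times the product of two `L²` functions, so
  -- it is integrable up to the endpoint.
  have hf : IntegrableOn f (Ioo l r) := by
    have h1 : Integrable (fun x => (vReal a x : ℂ) * ψ x) (volume.restrict (Ioo l r)) :=
      (memLp_vReal a l r).ofReal.integrable_mul hψ.memLp
    have h2 := h1.bdd_mul (c := K) (f := coeff a c)
      (continuous_coeff a c).aestronglyMeasurable
      (ae_restrict_of_forall_mem measurableSet_Ioo hK)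
    refine h2.neg.congr (Eventually.of_forall fun x => ?_)
    simp only [f, Pi.neg_apply]
    ring
  obtain ⟨d, hd⟩ := exists_between hlr
  have hi : IntervalIntegrable f volume l d := by
    rw [intervalIntegrable_iff_integrableOn_Ioo_of_le hd.1.le]
    exact hf.mono_set (Ioo_subset_Ioo_right hd.2.le)
  have hF := (intervalIntegral.continuousOn_primitive_interval' hi right_mem_uIcc) l left_mem_uIcc
  have hF' : Tendsto (fun x => ∫ t in d..x, f t) (𝓝[>] l) (𝓝 (∫ t in d..l, f t)) := by
    refine hF.tendsto.mono_left ?_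
    rw [uIcc_of_le hd.1.le]
    exact (nhdsWithin_Ioo_eq_nhdsGT hd.1).symm.le.trans (nhdsWithin_mono _ Ioo_subset_Icc_self)
  refine ⟨_, (hF'.add_const (lagrange a ψ (v a) d)).congr' ?_⟩
  filter_upwards [Ioo_mem_nhdsGT hd.1] with x hx
  have hsub : uIcc d x ⊆ Ioo l r :=
    ordConnected_Ioo.uIcc_subset hd ⟨hx.1, hx.2.trans hd.2⟩
  rw [intervalIntegral.integral_eq_sub_of_hasDerivAt
    (fun y hy => hψ.hasDerivAt_lagrange_v ha hne hL (hsub hy)), sub_add_cancel]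
  refine hi.mono_set ?_
  rw [uIcc_of_ge hx.2.le, uIcc_of_le hd.1.le]
  exact Icc_subset_Icc_left hx.1.le

/-! ### Passage across `a₃` and simplicity -/

lemma ne_of_mem_Ioo_one_two (ha : StrictMono a) : ∀ x ∈ Ioo (a 1) (a 2), ∀ i, x ≠ a i := by
  rintro x ⟨h1, h2⟩ i rfl
  rw [ha.lt_iff_lt] at h1 h2
  omega

lemma ne_of_mem_Ioo_two_three (ha : StrictMono a) : ∀ x ∈ Ioo (a 2) (a 3), ∀ i, x ≠ a i := by
  rintro x ⟨h1, h2⟩ i rfl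
  rw [ha.lt_iff_lt] at h1 h2
  omega

/-- An eigenfunction with `[ψ, v](a₂⁺) = 0` vanishes. -/
lemma MemDomain.ae_eq_zero (ha : StrictMono a) (hψ : MemDomain a ψ)
    (hL : L a ψ =ᵐ[volume.restrict (Ioo (a 1) (a 3))] fun x => c * ψ x)
    (hv : Tendsto (lagrange a ψ (v a)) (𝓝[>] (a 1)) (𝓝 0)) :
    ψ =ᵐ[volume.restrict (Ioo (a 1) (a 3))] fun _ => 0 := by
  have h12 : a 1 < a 2 := ha (by decide)
  have h23 : a 2 < a 3 := ha (by decide)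
  obtain ⟨hA, hψ0⟩ := hψ.mem_max.1.eqOn_zero ha (ne_of_mem_Ioo_one_two ha)
    (ae_restrict_of_ae_restrict_of_subset (Ioo_subset_Ioo_right h23.le) hL) hψ.bc_left hv
  have hu0 : Tendsto (lagrange a ψ u) (𝓝[<] (a 2)) (𝓝 0) := by
    refine tendsto_const_nhds.congr' (eventually_of_mem (Ioo_mem_nhdsLT h12) fun x hx => ?_)
    rw [lagrange_u]
    simp [hA hx]
  have hv0 : Tendsto (lagrange a ψ (v a)) (𝓝[<] (a 2)) (𝓝 0) := by
    refine tendsto_const_nhds.congr' (eventually_of_mem (Ioo_mem_nhdsLT h12) fun x hx => ?_)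
    rw [lagrange_v ha (ne_of_mem_Ioo_one_two ha x hx), hA hx, hψ0 hx]
    simp
  -- Both limits from the left at `a₃` are zero, so the transmission conditions supply zero initial
  -- data on the second interval.
  obtain ⟨p, hp1, hp2⟩ := hψ.trans_u
  obtain ⟨q, hq1, hq2⟩ := hψ.trans_v
  rw [tendsto_nhds_unique hp1 hu0] at hp2
  rw [tendsto_nhds_unique hq1 hv0] at hq2
  have h2 := (hψ.mem_max.2.eqOn_zero ha (ne_of_mem_Ioo_two_three ha)
    (ae_restrict_of_ae_restrict_of_subset (Ioo_subset_Ioo_left h12.le) hL) hp2 hq2).2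
  exact ae_of_ae_of_ae (ae_restrict_of_forall_mem measurableSet_Ioo hψ0)
    (ae_restrict_of_forall_mem measurableSet_Ioo h2)

lemma exists_of_mem_eigenspace (ha : StrictMono a) {f : H a} (hf : f ∈ eigenspace (LS a ha) c) :
    ∃ ψ, MemDomain a ψ ∧ f =ᵐ[volume.restrict (Ioo (a 1) (a 3))] ψ ∧
      L a ψ =ᵐ[volume.restrict (Ioo (a 1) (a 3))] fun x => c * ψ x := by
  obtain ⟨hd, he⟩ := hf
  obtain ⟨ψ, hψ, hfψ⟩ := (mem_domain_LS ha f).1 hd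
  refine ⟨ψ, hψ, hfψ, ?_⟩
  have h1 := LS_apply ha ⟨f, hd⟩ hψ hfψ
  rw [he] at h1
  filter_upwards [h1, Lp.coeFn_smul c f, hfψ] with x hx1 hx2 hx3
  rw [← hx1, hx2, Pi.smul_apply, hx3, smul_eq_mul]

/-- Every eigenvalue of `L_S` has multiplicity one. -/
theorem finrank_eigenspace_LS (ha : StrictMono a) (hc : IsEigenvalue (LS a ha) c) :
    Module.finrank ℂ (eigenspace (LS a ha) c) = 1 := by
  have h12 : a 1 < a 2 := ha (by decide)
  have h23 : a 2 < a 3 := ha (by decide)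
  obtain ⟨⟨f, hfd⟩, hf0, hfe⟩ := hc
  have hf : f ∈ eigenspace (LS a ha) c := ⟨hfd, hfe⟩
  refine finrank_eq_one_iff'.2 ⟨⟨f, hf⟩, fun h => hf0 (congrArg Subtype.val h), ?_⟩
  rintro ⟨g, hg⟩
  obtain ⟨ψ, hψ, hfψ, hLψ⟩ := exists_of_mem_eigenspace ha hf
  obtain ⟨φ, hφ, hgφ, hLφ⟩ := exists_of_mem_eigenspace ha hg
  have hlim (χ : ℝ → ℂ) (hχ : MemDomain a χ)
      (h : L a χ =ᵐ[volume.restrict (Ioo (a 1) (a 3))] fun x => c * χ x) :=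
    hχ.mem_max.1.exists_tendsto_lagrange_v ha h12 (ne_of_mem_Ioo_one_two ha)
      (ae_restrict_of_ae_restrict_of_subset (Ioo_subset_Ioo_right h23.le) h)
  obtain ⟨p, hp⟩ := hlim ψ hψ hLψ
  obtain ⟨q, hq⟩ := hlim φ hφ hLφ
  have hp0 : p ≠ 0 := by
    rintro rfl
    exact hf0 (Lp.ext ((hfψ.trans (hψ.ae_eq_zero ha hLψ hp)).trans (Lp.coeFn_zero _ _ _).symm))
  -- Chosen so that `φ + k ψ` has `[·, v](a₂⁺) = q + k p = 0`, and therefore vanishes almost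
  -- everywhere.
  set k : ℂ := -(q / p) with hk
  have hsum : MemDomain a (fun x => φ x + k * ψ x) := hφ.add ha (hψ.smul k)
  have hLsum : L a (fun x => φ x + k * ψ x) =ᵐ[volume.restrict (Ioo (a 1) (a 3))]
      fun x => c * (φ x + k * ψ x) := by
    filter_upwards [L_add_ae hφ.mem_max (hψ.smul k).mem_max, hLφ, hLψ] with x h1 h2 h3
    simp only [L_smul] at h1
    rw [← h1, h2, h3]
    ring
  have hvsum : Tendsto (lagrange a (fun x => φ x + k * ψ x) (v a)) (𝓝[>] (a 1)) (𝓝 0) := by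
    have h1 := hq.add (hp.const_mul k)
    have h2 : q + k * p = 0 := by rw [hk]; field_simp; ring
    rw [h2] at h1
    refine h1.congr' (eventually_of_mem (Ioo_mem_nhdsGT h12) fun x hx => ?_)
    rw [← lagrange_add hφ.mem_max.1 (hψ.smul k).mem_max.1 (v a) hx, lagrange_smul]
  have hz := hsum.ae_eq_zero ha hLsum hvsum
  refine ⟨-k, Subtype.ext (Lp.ext ?_)⟩
  refine (Lp.coeFn_smul (-k) f).trans ?_
  filter_upwards [hz, hfψ, hgφ] with x h1 h2 h3
  rw [Pi.smul_apply, smul_eq_mul, h2, h3]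
  linear_combination -h1

end SingularSL

end

theorem mainTheorem5 (a : Fin 4 → ℝ) (ha : StrictMono a) (c : ℂ)
    (hc : SingularSL.IsEigenvalue (SingularSL.LS a ha) c) :
    Module.finrank ℂ (SingularSL.eigenspace (SingularSL.LS a ha) c) = 1 :=
  SingularSL.finrank_eigenspace_LS ha hc
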